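/- Let $D$ be a squarefree positive integer, regard $\mathbb{Q}(\sqrt{-D})$ as a subfield of $\mathbb{C}$, and let $$Q_3=\{[z_1,z_2,z_3]\in P^2(\mathbb{C}) \mid z_1^2+z_2^2+z_3^2=0\}.$$ A point of $Q_3$ is called $\mathbb{Q}(\sqrt{-D})$-rational if it has homogeneous coordinates $(z_1,z_2,z_3)$ all of which lie in $\mathbb{Q}(\sqrt{-D})$. Then $Q_3$ has a $\mathbb{Q}(\sqrt{-D})$-rational point if and only if $D$ is not of the form $8k+7$ with $k$ a non-negative integer. Moreover, the equation $n_1^2+n_2^2+n_3^2=Dm^2$ has an integer solution $(n_1,n_2,n_3,m)\neq(0,0,0,0)$ if and only if $D$ is not of the form $8k+7$ with $k$ a non-negative integer. -/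

import Mathlib

/-- The complex projective quadric
`Q_N = {[z_1, …, z_N] ∈ P^{N-1}(ℂ) | z_1² + ⋯ + z_N² = 0}`.
The condition does not depend on the chosen homogeneous coordinates,
see `mk_mem_projQuadric_iff`. -/
def projQuadric (N : ℕ) : Set (Projectivization ℂ (Fin N → ℂ)) :=
  {p | ∑ i, p.rep i ^ 2 = 0}

/-- Membership in the quadric can be tested on any homogeneous coordinates. -/
theorem mk_mem_projQuadric_iff {N : ℕ} (z : Fin N → ℂ) (hz : z ≠ 0) :
    Projectivization.mk ℂ z hz ∈ projQuadric N ↔ ∑ i, z i ^ 2 = 0 := by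
  obtain ⟨a, ha⟩ := Projectivization.exists_smul_eq_mk_rep ℂ z hz
  have h : ∑ i, (Projectivization.mk ℂ z hz).rep i ^ 2 = (a : ℂ) ^ 2 * ∑ i, z i ^ 2 := by
    rw [← ha, Finset.mul_sum]
    refine Finset.sum_congr rfl fun i _ => ?_
    simp [Units.smul_def, mul_pow]
  simp [projQuadric, h]

/-- The subset `P^{N-1}(K) ⊆ P^{N-1}(ℂ)`, for a subfield `K` of `ℂ`: the points that
admit homogeneous coordinates all of which lie in `K`. -/
def projRationalPoints (K : IntermediateField ℚ ℂ) (N : ℕ) :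
    Set (Projectivization ℂ (Fin N → ℂ)) :=
  {p | ∃ (z : Fin N → ℂ) (hz : z ≠ 0), (∀ i, z i ∈ K) ∧ p = Projectivization.mk ℂ z hz}

/-- The imaginary quadratic field `ℚ(√-D)`, as a subfield of `ℂ`, where
`√-D = i √D`. -/
noncomputable def imagQuadraticField (D : ℕ) : IntermediateField ℚ ℂ :=
  IntermediateField.adjoin ℚ {Complex.I * (Real.sqrt (D : ℝ) : ℂ)}

/-! Write an isotropic vector as `a + bα` with `a, b` rational and `α² = -D`: then `a·a = D b·b` and
`a·b = 0`, so `a × b` has norm `D (b·b)²`. This makes rational points equivalent to integer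
solutions. For `D ≡ 7 mod 8`, descent modulo 8 excludes solutions. Otherwise Dirichlet's theorem and
reciprocity give a nonsquare `t = a² + b²` with `t ≡ -1 mod D` and `D` a square mod `t`
(`exists_auxiliary_sum_two_squares`). A pigeonhole argument then solves `D M² = Y² + t Z²`
(`exists_sq_eq_sq_add_mul_sq`), whose right side is a sum of three squares. -/

theorem eq_zero_of_three_squares_eq_zero {a b c : ℤ} (h : a ^ 2 + b ^ 2 + c ^ 2 = 0) :
    a = 0 ∧ b = 0 ∧ c = 0 := by
  refine ⟨?_, ?_, ?_⟩ <;> nlinarith [sq_nonneg a, sq_nonneg b, sq_nonneg c]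

/-! ### The ternary form: pigeonhole and descent -/

theorem exists_sq_eq_sq_add_mul_sq {D t : ℕ} {s : ℤ} (hD : 0 < D) (ht : ¬ IsSquare t)
    (htD : D ∣ t + 1) (hs : (t : ℤ) ∣ s ^ 2 - D) :
    ∃ M Y Z : ℤ, (M, Y, Z) ≠ (0, 0, 0) ∧ D * M ^ 2 = Y ^ 2 + t * Z ^ 2 := by
  have ht0 : 0 < t := Nat.pos_of_ne_zero fun h => ht (by simp [h])
  have : NeZero D := ⟨hD.ne'⟩
  have : NeZero t := ⟨ht0.ne'⟩
  -- The box `x ≤ √t`, `y ≤ √(Dt)`, `z ≤ √D` has more than `Dt` points, so two agree under `f`;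
  -- their difference makes `D x² - y² - t z²` divisible by `Dt`.
  let S : Finset (ℕ × ℕ × ℕ) := Finset.range (t.sqrt + 1) ×ˢ
    Finset.range ((D * t).sqrt + 1) ×ˢ Finset.range (D.sqrt + 1)
  let f : ℕ × ℕ × ℕ → ZMod D × ZMod t := fun v =>
    ((v.2.1 : ZMod D) - v.2.2, (v.2.1 : ZMod t) - s * v.1)
  have hcard : (Finset.univ : Finset (ZMod D × ZMod t)).card < S.card := by
    simp only [Finset.card_univ, Fintype.card_prod, ZMod.card, S, Finset.card_product,
      Finset.card_range]
    have h1 := Nat.lt_succ_sqrt t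
    have h2 := Nat.lt_succ_sqrt (D * t)
    have h3 := Nat.lt_succ_sqrt D
    simp only [Nat.succ_eq_add_one] at h1 h2 h3
    set a := t.sqrt + 1
    set b := (D * t).sqrt + 1
    set c := D.sqrt + 1
    refine lt_of_pow_lt_pow_left₀ 2 (Nat.zero_le _) ?_
    calc (D * t) ^ 2 = (t * (D * t)) * D := by ring
      _ < ((a * a) * (b * b)) * (c * c) :=
        mul_lt_mul'' (mul_lt_mul'' h1 h2 (by simp) (by simp)) h3 (by simp) (by simp)
      _ = (a * (b * c)) ^ 2 := by ring
  obtain ⟨⟨x₁, y₁, z₁⟩, hv, ⟨x₂, y₂, z₂⟩, hw, hne, hf⟩ :=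
    Finset.exists_ne_map_eq_of_card_lt_of_maps_to hcard (f := f) (fun _ _ => Finset.mem_univ _)
  simp only [S, Finset.mem_product, Finset.mem_range, Nat.lt_succ_iff, Nat.le_sqrt] at hv hw
  obtain ⟨hx₁, hy₁, hz₁⟩ := hv
  obtain ⟨hx₂, hy₂, hz₂⟩ := hw
  have key : ∀ a b n : ℕ, a * a ≤ n → b * b ≤ n → ((a : ℤ) - b) ^ 2 ≤ n := by
    intro a b n ha hb
    zify at ha hb
    rcases le_total a b with h | h <;> zify at h <;> nlinarith
  obtain ⟨x, hx⟩ : ∃ x : ℤ, x = x₁ - x₂ := ⟨_, rfl⟩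
  obtain ⟨y, hy⟩ : ∃ y : ℤ, y = y₁ - y₂ := ⟨_, rfl⟩
  obtain ⟨z, hz⟩ : ∃ z : ℤ, z = z₁ - z₂ := ⟨_, rfl⟩
  have bx : x ^ 2 ≤ t := hx ▸ key _ _ _ hx₁ hx₂
  have bY : y ^ 2 ≤ D * t := by have := key _ _ _ hy₁ hy₂; rw [hy]; exact_mod_cast this
  have bz : z ^ 2 ≤ D := hz ▸ key _ _ _ hz₁ hz₂
  have hxyz : (x, y, z) ≠ (0, 0, 0) := by
    intro h
    simp only [Prod.mk.injEq] at h
    apply hne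
    simp only [Prod.mk.injEq]
    omega
  have hf' : ((y₁ : ZMod D) - z₁ = y₂ - z₂) ∧ ((y₁ : ZMod t) - s * x₁ = y₂ - s * x₂) := by
    simpa [f] using hf
  have h1 : (D : ℤ) ∣ y - z := by
    rw [← ZMod.intCast_zmod_eq_zero_iff_dvd, hy, hz]
    push_cast
    linear_combination hf'.1
  have h2 : (t : ℤ) ∣ y - s * x := by
    rw [← ZMod.intCast_zmod_eq_zero_iff_dvd, hy, hx]
    push_cast
    linear_combination hf'.2
  have htD' : (D : ℤ) ∣ t + 1 := by exact_mod_cast htD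
  have hcop : IsCoprime (D : ℤ) t := by
    obtain ⟨k, hk⟩ := htD'
    exact ⟨k, -1, by linear_combination -hk⟩
  have hdvd : (D : ℤ) * t ∣ D * x ^ 2 - y ^ 2 - t * z ^ 2 := by
    refine hcop.mul_dvd ?_ ?_
    · obtain ⟨k, hk⟩ := htD'
      obtain ⟨l, hl⟩ := h1
      exact ⟨x ^ 2 - l * (y + z) - k * z ^ 2, by linear_combination -(y + z) * hl - z ^ 2 * hk⟩
    · obtain ⟨k, hk⟩ := hs
      obtain ⟨l, hl⟩ := h2
      exact ⟨-k * x ^ 2 - l * (y + s * x) - z ^ 2, by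
        linear_combination -(y + s * x) * hl - x ^ 2 * hk⟩
  obtain ⟨k, hk⟩ := hdvd
  have hDz : (0 : ℤ) < D := by exact_mod_cast hD
  have htz : (0 : ℤ) < t := by exact_mod_cast ht0
  have hDt : (0 : ℤ) < D * t := mul_pos hDz htz
  have ht' : ∀ n : ℤ, n ^ 2 ≠ t := fun n hn =>
    ht ⟨n.natAbs, by zify; rw [← sq, sq_abs, hn]⟩
  have hxt : x ^ 2 < t := lt_of_le_of_ne bx (ht' x)
  have hk1 : k < 1 := by
    by_contra! h
    nlinarith [mul_lt_mul_of_pos_left hxt hDz, sq_nonneg y, mul_nonneg htz.le (sq_nonneg z),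
      mul_le_mul_of_nonneg_left h hDt.le]
  -- `k ≤ -2` forces equality in both bounds, `y² = Dt` and `z² = D`, making `t = (y/z)²` a square.
  have hk2 : -2 < k := by
    by_contra! h
    have e1 := mul_le_mul_of_nonneg_left h hDt.le
    have e2 := mul_le_mul_of_nonneg_left bz htz.le
    have e3 := mul_nonneg hDz.le (sq_nonneg x)
    have e4 : y ^ 2 = D * t := by linarith
    have e5 : (t : ℤ) * z ^ 2 = t * D := by linarith
    have e6 : z ^ 2 = D := mul_left_cancel₀ htz.ne' e5
    obtain ⟨w, hw⟩ : z ∣ y := by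
      rw [← Int.pow_dvd_pow_iff two_ne_zero, e4, e6]
      exact dvd_mul_right _ _
    refine ht' w (mul_left_cancel₀ hDz.ne' ?_)
    rw [← e4, hw, mul_pow, e6]
  obtain rfl | rfl : k = 0 ∨ k = -1 := by omega
  · exact ⟨x, y, z, hxyz, by linear_combination hk⟩
  -- Here `D (x² + t) = y² + t z²`; multiply by `x² + t` and compose the norm forms.
  · refine ⟨x ^ 2 + t, x * y - t * z, y + x * z, ?_, ?_⟩
    · intro h
      simp only [Prod.mk.injEq] at h
      nlinarith [sq_nonneg x, h.1]
    · linear_combination (x ^ 2 + t) * hk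

theorem eq_zero_of_three_squares_eq_mul_sq {D : ℤ} (hD : D % 8 = 7) (n : ℕ) :
    ∀ a b c m : ℤ, m.natAbs ≤ n → a ^ 2 + b ^ 2 + c ^ 2 = D * m ^ 2 → m = 0 := by
  induction n using Nat.strong_induction_on with
  | _ n ih =>
  intro a b c m hm h
  by_contra hm0
  -- In `ZMod 8`, `4 * x = 0` encodes that `x` is even; halving all four variables gives the
  -- descent.
  have key : ∀ x y z w : ZMod 8, x ^ 2 + y ^ 2 + z ^ 2 = 7 * w ^ 2 →
      4 * x = 0 ∧ 4 * y = 0 ∧ 4 * z = 0 ∧ 4 * w = 0 := by decide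
  have hD8 : (D : ZMod 8) = 7 := by
    have : ((D % 8 : ℤ) : ZMod 8) = D := ZMod.intCast_mod D 8
    rw [← this, hD]; rfl
  have h8 := congrArg (Int.cast : ℤ → ZMod 8) h
  push_cast at h8
  rw [hD8] at h8
  have even : ∀ x : ℤ, 4 * (x : ZMod 8) = 0 → ∃ y, x = 2 * y := by
    intro x hx
    have : ((4 * x : ℤ) : ZMod 8) = 0 := by push_cast; exact hx
    rw [ZMod.intCast_zmod_eq_zero_iff_dvd] at this
    exact ⟨x / 2, by push_cast at this; omega⟩
  obtain ⟨h1, h2, h3, h4⟩ := key _ _ _ _ h8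
  obtain ⟨a, rfl⟩ := even _ h1
  obtain ⟨b, rfl⟩ := even _ h2
  obtain ⟨c, rfl⟩ := even _ h3
  obtain ⟨m, rfl⟩ := even _ h4
  have : m = 0 := ih m.natAbs (by omega) a b c m le_rfl (by linarith)
  omega

/-! ### Choosing the auxiliary integer `t` -/

theorem exists_sq_sub_dvd_of_jacobiSym_eq_one {D q : ℕ} (hq : q.Prime) (h : jacobiSym D q = 1) :
    ∃ s : ℤ, (q : ℤ) ∣ s ^ 2 - D := by
  have : Fact q.Prime := ⟨hq⟩
  obtain ⟨r, hr⟩ := ZMod.isSquare_of_jacobiSym_eq_one h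
  refine ⟨r.val, ?_⟩
  rw [← ZMod.intCast_zmod_eq_zero_iff_dvd]
  push_cast at hr ⊢
  rw [ZMod.natCast_zmod_val, hr]
  ring

theorem exists_prime_modEq_and_modEq {N m a c : ℕ} (hN : 0 < N) (hm : m ≠ 0) (h : m.Coprime N)
    (ha : a.Coprime m) (hc : c.Coprime N) :
    ∃ q : ℕ, q.Prime ∧ q ≡ a [MOD m] ∧ q ≡ c [MOD N] := by
  obtain ⟨k, hk₁, hk₂⟩ := Nat.chineseRemainder h a c
  have hk : k.Coprime (m * N) := by
    refine Nat.Coprime.mul_right ?_ ?_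
    · rw [Nat.Coprime, hk₁.gcd_eq]; exact ha
    · rw [Nat.Coprime, hk₂.gcd_eq]; exact hc
  obtain ⟨q, -, hq, hqk⟩ := Nat.forall_exists_prime_gt_and_modEq 0 (mul_ne_zero hm hN.ne') hk
  exact ⟨q, hq, (hqk.of_mul_right N).trans hk₁, (hqk.of_mul_left m).trans hk₂⟩

theorem jacobiSym_congr {a b : ℤ} {N : ℕ} (h : (N : ℤ) ∣ a - b) :
    jacobiSym a N = jacobiSym b N :=
  jacobiSym.mod_left' (Int.modEq_iff_dvd.2 h).symm

/-- A prime `q ≡ 1 mod 4` is a sum of two squares, and reciprocity turns the symbol of `D` at `q`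
into one fixed by `q mod D`. Take `t = q`, except `t = 2q` when `D ≡ 3 mod 8`. -/
theorem exists_auxiliary_sum_two_squares {D : ℕ} (hD : Squarefree D) (h7 : D % 8 ≠ 7) :
    ∃ t a b : ℕ, ¬ IsSquare t ∧ D ∣ t + 1 ∧ t = a ^ 2 + b ^ 2 ∧ ∃ s : ℤ, (t : ℤ) ∣ s ^ 2 - D := by
  have hD0 : 0 < D := Nat.pos_of_ne_zero hD.ne_zero
  have hpred : ∀ N : ℕ, 0 < N → (N - 1).Coprime N := fun N hN => by
    have := Nat.coprime_self_add_right (m := N - 1) (n := 1)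
    rw [Nat.sub_add_cancel hN] at this
    exact this.2 (Nat.coprime_one_right _)
  have hdvd : ∀ {N q : ℕ}, 0 < N → q ≡ N - 1 [MOD N] → N ∣ q + 1 := fun {N q} hN h => by
    rw [← Nat.modEq_zero_iff_dvd]
    refine (h.add_right 1).trans ?_
    rw [Nat.sub_add_cancel hN, Nat.modEq_zero_iff_dvd]
  have hJ : ∀ {N q : ℕ}, q % 4 = 1 → Odd N → N ∣ q + 1 →
      jacobiSym N q = ZMod.χ₄ N := fun {N q} hq hN h => by
    rw [← jacobiSym.quadratic_reciprocity_one_mod_four hq hN, ← jacobiSym.at_neg_one hN]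
    refine jacobiSym_congr ?_
    rw [sub_neg_eq_add]
    exact_mod_cast h
  have h4 : ∀ {N : ℕ}, Odd N → Nat.Coprime 4 N := fun hN =>
    Nat.Coprime.pow_left 2 hN.coprime_two_left
  have h8 : ∀ {N : ℕ}, Odd N → Nat.Coprime 8 N := fun hN =>
    Nat.Coprime.pow_left 3 hN.coprime_two_left
  have hsum : ∀ {q : ℕ}, q.Prime → q % 4 = 1 → ∃ a b : ℕ, q = a ^ 2 + b ^ 2 :=
    fun {q} hq hq4 => by
      have : Fact q.Prime := ⟨hq⟩
      obtain ⟨a, b, h⟩ := Nat.Prime.sq_add_sq (p := q) (by omega)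
      exact ⟨a, b, h.symm⟩
  rcases Nat.even_or_odd D with heven | hodd
  · obtain ⟨N, rfl⟩ := heven.two_dvd
    have hN : Odd N := by
      rw [← Nat.not_even_iff_odd]
      intro h
      have := hD 2 (Nat.mul_dvd_mul_left 2 h.two_dvd)
      simp at this
    have hN0 : 0 < N := hN.pos
    -- For `D = 2N` the symbol at `q` is `(2/q)(-1/N)`; the class of `q` mod 8 is chosen to make it
    -- 1.
    obtain ⟨c, hc, hc4, hχ⟩ : ∃ c : ℕ, c.Coprime 8 ∧ c % 4 = 1 ∧
        ∀ q : ℕ, q ≡ c [MOD 8] → jacobiSym 2 q * ZMod.χ₄ N = 1 := by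
      have hN2 := Nat.odd_iff.1 hN
      rcases (by omega : N % 4 = 1 ∨ N % 4 = 3) with h | h
      · refine ⟨1, by decide, rfl, fun q hq => ?_⟩
        have hq : q % 8 = 1 := hq
        rw [jacobiSym.at_two (Nat.odd_iff.2 (by omega)), ZMod.χ₈_nat_mod_eight, hq,
          ZMod.χ₄_nat_one_mod_four h]
        decide
      · refine ⟨5, by decide, rfl, fun q hq => ?_⟩
        have hq : q % 8 = 5 := hq
        rw [jacobiSym.at_two (Nat.odd_iff.2 (by omega)), ZMod.χ₈_nat_mod_eight, hq,
          ZMod.χ₄_nat_three_mod_four h]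
        decide
    obtain ⟨q, hq, hq8, hqN⟩ := exists_prime_modEq_and_modEq hN0 (by decide) (h8 hN) hc (hpred N hN0)
    have hq4 : q % 4 = 1 := by have : q % 8 = c % 8 := hq8; omega
    obtain ⟨a, b, hab⟩ := hsum hq hq4
    refine ⟨q, a, b, hq.prime.irreducible.not_isSquare, ?_, hab,
      exists_sq_sub_dvd_of_jacobiSym_eq_one hq ?_⟩
    · exact hN.coprime_two_left.mul_dvd_of_dvd_of_dvd (by omega) (hdvd hN0 hqN)
    · push_cast
      rw [jacobiSym.mul_left, hJ hq4 hN (hdvd hN0 hqN), hχ q hq8]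
  · have hD2 := Nat.odd_iff.1 hodd
    rcases (by omega : D % 4 = 1 ∨ D % 8 = 3) with h | h
    · obtain ⟨q, hq, hq4, hqD⟩ := exists_prime_modEq_and_modEq (a := 1) hD0 (by decide) (h4 hodd)
        (by decide) (hpred D hD0)
      have hq4 : q % 4 = 1 := hq4
      obtain ⟨a, b, hab⟩ := hsum hq hq4
      refine ⟨q, a, b, hq.prime.irreducible.not_isSquare, hdvd hD0 hqD, hab,
        exists_sq_sub_dvd_of_jacobiSym_eq_one hq ?_⟩
      rw [hJ hq4 hodd (hdvd hD0 hqD), ZMod.χ₄_nat_one_mod_four h]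
    -- With `q ≡ -1` the symbol would be `(-1/D) = -1`. Taking `2q ≡ -1 mod D` instead brings in
    -- `(2/D) = -1`, which corrects the sign.
    · obtain ⟨c, hc⟩ : ∃ c, D = 2 * c + 1 := id hodd
      have hcD : c.Coprime D := by rw [hc]; simp
      obtain ⟨q, hq, hq4, hqD⟩ := exists_prime_modEq_and_modEq (a := 1) hD0 (by decide) (h4 hodd)
        (by decide) hcD
      have hq4 : q % 4 = 1 := hq4
      have hdvd2 : D ∣ 2 * q + 1 := by
        rw [← Nat.modEq_zero_iff_dvd]
        refine ((hqD.mul_left 2).add_right 1).trans ?_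
        rw [← hc, Nat.modEq_zero_iff_dvd]
      obtain ⟨a, b, hab⟩ := hsum hq hq4
      have hJ1 : jacobiSym D q = 1 := by
        rw [← jacobiSym.quadratic_reciprocity_one_mod_four hq4 hodd]
        have e1 : jacobiSym 2 D * jacobiSym q D = jacobiSym (-1) D := by
          rw [← jacobiSym.mul_left]
          refine jacobiSym_congr ?_
          rw [sub_neg_eq_add]
          exact_mod_cast hdvd2
        rw [jacobiSym.at_two hodd, jacobiSym.at_neg_one hodd, ZMod.χ₈_nat_mod_eight, h,
          ZMod.χ₄_nat_three_mod_four (by omega : D % 4 = 3),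
          show ZMod.χ₈ ((3 : ℕ) : ZMod 8) = -1 by decide] at e1
        linarith
      obtain ⟨s, hs⟩ := exists_sq_sub_dvd_of_jacobiSym_eq_one hq hJ1
      refine ⟨2 * q, a + b, ((a : ℤ) - b).natAbs, ?_, hdvd2, ?_, ?_⟩
      · rintro ⟨r, hr⟩
        obtain ⟨u, rfl⟩ : 2 ∣ r := (or_self_iff).1 (Nat.prime_two.dvd_mul.1 ⟨q, hr.symm⟩)
        have : q = 2 * (u * u) := by linarith
        omega
      · zify at hab ⊢
        rw [sq_abs, hab]
        ring
      · have hcop : IsCoprime (2 : ℤ) q := by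
          exact_mod_cast Nat.isCoprime_iff_coprime.2
            (Nat.odd_iff.2 (by omega : q % 2 = 1)).coprime_two_left
        -- An odd root is needed for divisibility by 2 as well; adding the odd `q` changes parity.
        obtain ⟨s', hs', hodd'⟩ : ∃ s' : ℤ, (q : ℤ) ∣ s' ^ 2 - D ∧ Odd s' := by
          rcases Int.even_or_odd s with hs2 | hs2
          · refine ⟨s + q, ?_, hs2.add_odd ?_⟩
            · obtain ⟨k, hk⟩ := hs
              exact ⟨k + 2 * s + q, by linear_combination hk⟩
            · exact_mod_cast Nat.odd_iff.2 (by omega : q % 2 = 1)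
          · exact ⟨s, hs, hs2⟩
        refine ⟨s', ?_⟩
        push_cast
        refine hcop.mul_dvd ?_ hs'
        exact (hodd'.pow.sub_odd (by exact_mod_cast hodd)).two_dvd

/-! ### Isotropic vectors over the quadratic field -/

theorem I_mul_sqrt_sq (D : ℕ) : (Complex.I * (Real.sqrt (D : ℝ) : ℂ)) ^ 2 = -D := by
  rw [mul_pow, Complex.I_sq, ← Complex.ofReal_pow, Real.sq_sqrt (Nat.cast_nonneg D)]
  simp

theorem exists_rat_coords_of_mem_imagQuadraticField {D : ℕ} {x : ℂ}
    (hx : x ∈ imagQuadraticField D) :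
    ∃ a b : ℚ, x = a + b * (Complex.I * (Real.sqrt (D : ℝ) : ℂ)) := by
  have hα := I_mul_sqrt_sq D
  have halg : IsIntegral ℚ (Complex.I * (Real.sqrt (D : ℝ) : ℂ)) := by
    refine IsIntegral.of_pow two_pos ?_
    rw [hα]
    have := isIntegral_algebraMap (R := ℚ) (A := ℂ) (x := -(D : ℚ))
    rwa [map_neg, map_natCast] at this
  rw [imagQuadraticField, ← IntermediateField.mem_toSubalgebra,
    IntermediateField.adjoin_simple_toSubalgebra_of_isAlgebraic halg.isAlgebraic] at hx
  induction hx using Algebra.adjoin_induction with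
  | mem x hx => exact ⟨0, 1, by simpa using hx⟩
  | algebraMap r => exact ⟨r, 0, by simp⟩
  | add x y _ _ hx hy =>
    obtain ⟨a, b, rfl⟩ := hx
    obtain ⟨c, d, rfl⟩ := hy
    exact ⟨a + c, b + d, by push_cast; ring⟩
  | mul x y _ _ hx hy =>
    obtain ⟨a, b, rfl⟩ := hx
    obtain ⟨c, d, rfl⟩ := hy
    exact ⟨a * c - D * (b * d), a * d + b * c, by push_cast; linear_combination (b * d : ℂ) * hα⟩

theorem rat_coords_eq_zero {D : ℕ} (hD : 0 < D) {a b : ℚ}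
    (h : (a : ℂ) + b * (Complex.I * (Real.sqrt (D : ℝ) : ℂ)) = 0) : a = 0 ∧ b = 0 := by
  have hD' : (0 : ℝ) < Real.sqrt D := Real.sqrt_pos.2 (by exact_mod_cast hD)
  have hre := congrArg Complex.re h
  have him := congrArg Complex.im h
  simp at hre him
  exact ⟨hre, him.resolve_right (by omega)⟩

theorem exists_int_of_rat_three_squares {D : ℕ} {x y z m : ℚ} (hm : m ≠ 0)
    (h : x ^ 2 + y ^ 2 + z ^ 2 = D * m ^ 2) :
    ∃ n₁ n₂ n₃ k : ℤ, (n₁, n₂, n₃, k) ≠ (0, 0, 0, 0) ∧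
      n₁ ^ 2 + n₂ ^ 2 + n₃ ^ 2 = (D : ℤ) * k ^ 2 := by
  refine ⟨x.num * (y.den * z.den * m.den), y.num * (x.den * z.den * m.den),
    z.num * (x.den * y.den * m.den), m.num * (x.den * y.den * z.den), ?_, ?_⟩
  · simp [hm]
  · have hx := Rat.mul_den_eq_num x
    have hy := Rat.mul_den_eq_num y
    have hz := Rat.mul_den_eq_num z
    have hk := Rat.mul_den_eq_num m
    qify
    rw [← hx, ← hy, ← hz, ← hk]
    linear_combination ((x.den : ℚ) * y.den * z.den * m.den) ^ 2 * h

theorem exists_int_of_isotropic {D : ℕ} (hD : 0 < D) {z : Fin 3 → ℂ} (hz : z ≠ 0)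
    (hK : ∀ i, z i ∈ imagQuadraticField D) (h : ∑ i, z i ^ 2 = 0) :
    ∃ n₁ n₂ n₃ m : ℤ, (n₁, n₂, n₃, m) ≠ (0, 0, 0, 0) ∧
      n₁ ^ 2 + n₂ ^ 2 + n₃ ^ 2 = (D : ℤ) * m ^ 2 := by
  choose a b hab using fun i => exists_rat_coords_of_mem_imagQuadraticField (hK i)
  have hα := I_mul_sqrt_sq D
  have hDQ : (0 : ℚ) < D := by exact_mod_cast hD
  obtain ⟨h₁, h₂⟩ := rat_coords_eq_zero hD
    (a := a 0 ^ 2 + a 1 ^ 2 + a 2 ^ 2 - D * (b 0 ^ 2 + b 1 ^ 2 + b 2 ^ 2))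
    (b := 2 * (a 0 * b 0 + a 1 * b 1 + a 2 * b 2)) (by
      rw [Fin.sum_univ_three, hab 0, hab 1, hab 2] at h
      push_cast
      linear_combination h - ((b 0 : ℂ) ^ 2 + b 1 ^ 2 + b 2 ^ 2) * hα)
  -- The cross product `a × b`, by Lagrange's identity; `b·b = 0` would force `a = b = 0`.
  refine exists_int_of_rat_three_squares (x := a 1 * b 2 - a 2 * b 1)
    (y := a 2 * b 0 - a 0 * b 2) (z := a 0 * b 1 - a 1 * b 0)
    (m := b 0 ^ 2 + b 1 ^ 2 + b 2 ^ 2) ?_ ?_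
  · intro hb
    rw [hb, mul_zero, sub_zero] at h₁
    have zero : ∀ c : Fin 3 → ℚ, c 0 ^ 2 + c 1 ^ 2 + c 2 ^ 2 = 0 → ∀ i, c i = 0 := by
      intro c hc i
      have : ∑ i, c i ^ 2 = 0 := by rwa [Fin.sum_univ_three]
      rw [Finset.sum_eq_zero_iff_of_nonneg fun i _ => sq_nonneg _] at this
      simpa using this i (Finset.mem_univ i)
    refine hz (funext fun i => ?_)
    rw [hab i, zero a h₁ i, zero b hb i]
    simp
  · linear_combination (b 0 ^ 2 + b 1 ^ 2 + b 2 ^ 2) * h₁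
      - (a 0 * b 0 + a 1 * b 1 + a 2 * b 2) / 2 * h₂

theorem exists_isotropic_of_int {D : ℕ} (hD : 0 < D) {n₁ n₂ n₃ m : ℤ}
    (hne : (n₁, n₂, n₃, m) ≠ (0, 0, 0, 0))
    (h : n₁ ^ 2 + n₂ ^ 2 + n₃ ^ 2 = (D : ℤ) * m ^ 2) :
    ∃ z : Fin 3 → ℂ, z ≠ 0 ∧ (∀ i, z i ∈ imagQuadraticField D) ∧ ∑ i, z i ^ 2 = 0 := by
  obtain ⟨α, hαdef⟩ : ∃ α : ℂ, α = Complex.I * (Real.sqrt (D : ℝ) : ℂ) := ⟨_, rfl⟩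
  have hα : α ^ 2 = -D := hαdef ▸ I_mul_sqrt_sq D
  have hαK : α ∈ imagQuadraticField D :=
    hαdef ▸ IntermediateField.mem_adjoin_simple_self ℚ _
  have hm : m ≠ 0 := by
    rintro rfl
    obtain ⟨rfl, rfl, rfl⟩ := eq_zero_of_three_squares_eq_zero (h.trans (by simp))
    exact hne rfl
  have hα0 : α ≠ 0 := by
    rintro rfl
    simp at hα
    omega
  have hmα : (m : ℂ) * α ≠ 0 := mul_ne_zero (by exact_mod_cast hm) hα0
  have hC : (n₁ : ℂ) ^ 2 + n₂ ^ 2 + n₃ ^ 2 = D * m ^ 2 := by exact_mod_cast h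
  have hint : ∀ n : ℤ, (n : ℂ) ∈ imagQuadraticField D := fun n => intCast_mem _ n
  by_cases hn : n₁ = 0 ∧ n₂ = 0
  · obtain ⟨rfl, rfl⟩ := hn
    refine ⟨![m * α, n₃, 0], fun h0 => hmα (by simpa using congrFun h0 0), ?_, ?_⟩
    · intro i
      fin_cases i
      exacts [mul_mem (hint _) hαK, hint _, zero_mem _]
    · simp [Fin.sum_univ_three]
      push_cast at hC
      linear_combination hC + (m : ℂ) ^ 2 * hα
  -- This is `n × (e₃ × n) + mα (n × e₃)`: orthogonal terms of opposite norm. It vanishes when `n`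
  -- is parallel to `e₃`, hence the case split.
  · refine ⟨![-(n₃ * n₁) + m * α * n₂, -(n₃ * n₂) - m * α * n₁, n₁ ^ 2 + n₂ ^ 2], ?_, ?_, ?_⟩
    · intro h0
      have h2 := congrFun h0 2
      simp at h2
      norm_cast at h2
      exact hn ⟨by nlinarith [sq_nonneg n₁, sq_nonneg n₂], by nlinarith [sq_nonneg n₁, sq_nonneg n₂]⟩
    · intro i
      fin_cases i
      exacts [add_mem (neg_mem (mul_mem (hint _) (hint _))) (mul_mem (mul_mem (hint _) hαK) (hint _)),
        sub_mem (neg_mem (mul_mem (hint _) (hint _))) (mul_mem (mul_mem (hint _) hαK) (hint _)),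
        add_mem (pow_mem (hint _) 2) (pow_mem (hint _) 2)]
    · simp [Fin.sum_univ_three]
      linear_combination ((n₁ : ℂ) ^ 2 + n₂ ^ 2) * hC + (m : ℂ) ^ 2 * (n₁ ^ 2 + n₂ ^ 2) * hα

/-! ### Both equivalences -/

theorem exists_int_three_squares_iff {D : ℕ} (hD : Squarefree D) :
    (∃ n₁ n₂ n₃ m : ℤ, (n₁, n₂, n₃, m) ≠ (0, 0, 0, 0) ∧
        n₁ ^ 2 + n₂ ^ 2 + n₃ ^ 2 = (D : ℤ) * m ^ 2) ↔ ¬ ∃ k : ℕ, D = 8 * k + 7 := by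
  constructor
  · rintro ⟨n₁, n₂, n₃, m, hne, h⟩ ⟨k, hk⟩
    obtain rfl := eq_zero_of_three_squares_eq_mul_sq (by omega) m.natAbs n₁ n₂ n₃ m le_rfl h
    obtain ⟨rfl, rfl, rfl⟩ := eq_zero_of_three_squares_eq_zero (h.trans (by simp))
    exact hne rfl
  · intro h
    obtain ⟨t, a, b, ht, htD, hab, s, hs⟩ :=
      exists_auxiliary_sum_two_squares hD fun h7 => h ⟨D / 8, by omega⟩
    obtain ⟨M, Y, Z, hne, hMYZ⟩ :=
      exists_sq_eq_sq_add_mul_sq (Nat.pos_of_ne_zero hD.ne_zero) ht htD hs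
    have hab' : (t : ℤ) = a ^ 2 + b ^ 2 := by exact_mod_cast hab
    refine ⟨Y, a * Z, b * Z, M, fun h0 => hne ?_, by rw [hMYZ, hab']; ring⟩
    simp only [Prod.mk.injEq] at h0
    obtain ⟨rfl, -, -, rfl⟩ := h0
    have ht0 : (t : ℤ) ≠ 0 := fun h0 => ht (by rw [Int.natCast_eq_zero.1 h0]; exact ⟨0, rfl⟩)
    have hZ : (t : ℤ) * Z ^ 2 = 0 := by linarith
    simpa [Int.natCast_ne_zero.1 ht0] using hZ

theorem proposition4p2 (D : ℕ) (hD : Squarefree D) :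
    ((∃ p : Projectivization ℂ (Fin 3 → ℂ),
        p ∈ projQuadric 3 ∧ p ∈ projRationalPoints (imagQuadraticField D) 3) ↔
      ¬ ∃ k : ℕ, D = 8 * k + 7) ∧
    ((∃ n₁ n₂ n₃ m : ℤ, (n₁, n₂, n₃, m) ≠ (0, 0, 0, 0) ∧
        n₁ ^ 2 + n₂ ^ 2 + n₃ ^ 2 = (D : ℤ) * m ^ 2) ↔
      ¬ ∃ k : ℕ, D = 8 * k + 7) := by
  have hD0 : 0 < D := Nat.pos_of_ne_zero hD.ne_zero
  refine ⟨?_, exists_int_three_squares_iff hD⟩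
  rw [← exists_int_three_squares_iff hD]
  constructor
  · rintro ⟨p, hp, z, hz, hK, rfl⟩
    exact exists_int_of_isotropic hD0 hz hK ((mk_mem_projQuadric_iff z hz).1 hp)
  · rintro ⟨n₁, n₂, n₃, m, hne, h⟩
    obtain ⟨z, hz, hK, h0⟩ := exists_isotropic_of_int hD0 hne h
    exact ⟨_, (mk_mem_projQuadric_iff z hz).2 h0, z, hz, hK, rfl⟩
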